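/- A write-once Turing machine is a deterministic Turing machine with one tape, infinite to the right only, one read/write head and the two tape symbols $0$ (blank) and $1$ (marked), none of whose transitions writes $0$ to a cell that contains $1$ (marking a marked cell again is allowed; a left move on the leftmost cell leaves the head in place). A word $w\in\{0,1\}^*$ is presented to it on the leftmost cells of the tape, each bit of $w$ being encoded in two cells ($0$ as $01$ and $1$ as $10$), with all other cells blank and the head on the leftmost cell. Let $\mathrm{DWO\text{-}PSPACE}$ be the class of the languages $L\subseteq\{0,1\}^*$ for which there are such a write-once machine and a polynomial $p$ such that the machine, on every input $w$, halts, accepts if and only if $w\in L$, and scans only cells among the first $p(|w|)$ cells of the tape. Let $\mathrm{P}$ be the usual class of the languages $L\subseteq\{0,1\}^*$ that are decided in polynomial time by an ordinary deterministic Turing machine (with any finite tape alphabet). Then $$\mathrm{DWO\text{-}PSPACE}=\mathrm{P}.$$ -/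

import Mathlib

namespace WriteOnce

/-- The possible moves of the head. -/
inductive Move where
  | left
  | right
  | stay

/-- The head position after a move, on a tape whose cells are numbered `0, 1, 2, …`.
A left move on the leftmost cell leaves the head where it is. -/
def Move.apply : Move → ℕ → ℕ
  | .left, i => i - 1
  | .right, i => i + 1
  | .stay, i => i

/-- A deterministic Turing machine with one tape and one read/write head over the tape
alphabet `Γ`. In state `q` reading `a`, the machine halts if `δ q a = none`, and if
`δ q a = some (q', b, m)` it writes `b`, makes the move `m` and enters state `q'`. -/
structure TM (Γ : Type) where
  /-- the states -/
  Q : Type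
  /-- there are finitely many of them -/
  [finQ : Fintype Q]
  /-- the initial state -/
  start : Q
  /-- the accepting states -/
  accept : Q → Bool
  /-- the transition function -/
  δ : Q → Γ → Option (Q × Γ × Move)

/-- A configuration of a machine: its state, the position of the head and the contents of
the tape, which is infinite to the right only. -/
structure Cfg {Γ : Type} (M : TM Γ) where
  /-- the current state -/
  state : M.Q
  /-- the cell that is scanned -/
  head : ℕ
  /-- the contents of the tape -/
  tape : ℕ → Γ

namespace TM

variable {Γ : Type}

/-- The initial configuration: the word `x` is written on the leftmost cells, all the other
cells are blank, and the head is on the leftmost cell. -/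
def init (M : TM Γ) (blank : Γ) (x : List Γ) : Cfg M where
  state := M.start
  head := 0
  tape := fun i => x.getD i blank

/-- One step of the computation; `none` if the machine halts. -/
def step (M : TM Γ) (c : Cfg M) : Option (Cfg M) :=
  (M.δ c.state (c.tape c.head)).map fun r =>
    { state := r.1
      head := r.2.2.apply c.head
      tape := Function.update c.tape c.head r.2.1 }

/-- `c` is a halting configuration. -/
def Halted (M : TM Γ) (c : Cfg M) : Prop := M.step c = none

/-- The configuration reached from `c` after `t` steps, or the halting configuration if the
machine halts earlier. -/
def run (M : TM Γ) (c : Cfg M) (t : ℕ) : Cfg M :=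
  (fun c => (M.step c).getD c)^[t] c

/-- Started in `c`, the machine halts after at most `t` steps, and it accepts if and only
if `p` holds. -/
def AnswersWithin (M : TM Γ) (c : Cfg M) (t : ℕ) (p : Prop) : Prop :=
  M.Halted (M.run c t) ∧ (M.accept (M.run c t).state = true ↔ p)

/-- Started in `c`, the machine never scans a cell other than the `s` leftmost ones. -/
def UsesSpace (M : TM Γ) (c : Cfg M) (s : ℕ) : Prop :=
  ∀ t, (M.run c t).head < s

/-- A machine over the two-symbol alphabet (`false` is a blank cell, `true` a marked one) is
write-once if no transition writes a blank to a marked cell. Marking a marked cell again is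
allowed. -/
def IsWriteOnce (M : TM Bool) : Prop :=
  ∀ q q' m, M.δ q true ≠ some (q', false, m)

end TM

/-- The cells on which a binary word is presented to a machine whose only symbols are blank
and marked: each bit takes two cells, `0` is blank-marked and `1` is marked-blank. -/
def encode (w : List Bool) : List Bool :=
  w.flatMap fun b => [b, !b]

/-- The languages decided by a deterministic one-tape write-once Turing machine over the
two-symbol alphabet that halts on every input and works in polynomial space. -/
def DWOPSpace : Set (Language Bool) :=
  {L | ∃ (M : TM Bool) (p : Polynomial ℕ), M.IsWriteOnce ∧
    ∀ w : List Bool,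
      (∃ t, M.AnswersWithin (M.init false (encode w)) t (w ∈ L)) ∧
      M.UsesSpace (M.init false (encode w)) (p.eval w.length)}

/-- The class P: the languages decided in polynomial time by an ordinary deterministic
one-tape Turing machine, with any finite tape alphabet, in which `letter 0` and `letter 1`
are two distinct symbols other than the blank. -/
def P : Set (Language Bool) :=
  {L | ∃ (Γ : Type) (_ : Fintype Γ) (blank : Γ) (letter : Bool → Γ) (M : TM Γ)
      (p : Polynomial ℕ), Function.Injective letter ∧ (∀ b, letter b ≠ blank) ∧
    ∀ w : List Bool,
      M.AnswersWithin (M.init blank (w.map letter)) (p.eval w.length) (w ∈ L)}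

end WriteOnce

namespace WriteOnce

/-! From left to right: marks are never erased, so along a run the number of marked cells can only
grow, and two moments with equally many marks have the same tape. State, head position and number of
marks thus determine the configuration, and a halting run in space `s` has at most `|Q| * (s * (s +
1))` steps (`TM.IsWriteOnce.halted_run`). An ordinary machine imitates this run in real time with
two cells packed into one (`TM.step_packed`), which also fits the two-cell encoding of the input.

From right to left: memory that cannot be erased can still serve as a queue. Reading an entry
destroys it by marking both of its cells, and new entries go onto fresh cells at the right end, so
the queue crawls along the tape (`QueueMachine.answersWithin`). A queue suffices to compute with: it
holds the current configuration as a row of symbols, and while this row is consumed the next one is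
produced from a local rule on three adjacent cells (`TM.Cell.next_cell`, `within_rows`). All
overheads are polynomial, and polynomial time implies polynomial space
(`TM.AnswersWithin.usesSpace`). -/

/-- `Within f n c d`: iterating the partial map `f` leads from `c` to `d` in at most `n` steps. -/
inductive Within {σ : Type*} (f : σ → Option σ) : ℕ → σ → σ → Prop
  | refl (n : ℕ) (c : σ) : Within f n c c
  | step {n : ℕ} {c c' d : σ} : f c = some c' → Within f n c' d → Within f (n + 1) c d

namespace Within

variable {σ : Type*} {f : σ → Option σ}

theorem mono {m n : ℕ} {c d : σ} (h : Within f m c d) (hmn : m ≤ n) : Within f n c d := by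
  induction h generalizing n with
  | refl => exact .refl _ _
  | step hs _ ih =>
    obtain ⟨k, rfl⟩ : ∃ k, n = k + 1 := ⟨n - 1, by omega⟩
    exact .step hs (ih (by omega))

theorem trans {m n : ℕ} {c d e : σ} (h : Within f m c d) (h' : Within f n d e) :
    Within f (m + n) c e := by
  induction h with
  | refl => exact h'.mono (by omega)
  | step hs _ ih => exact (Within.step hs (ih h')).mono (by omega)

theorem single {c d : σ} (h : f c = some d) : Within f 1 c d := .step h (.refl _ _)

/-- If every step of `f` is simulated by at most `k` steps of `g`, then `n` steps are simulated
by at most `n * k` steps. -/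
theorem simulate {τ : Type*} {g : τ → Option τ} (φ : σ → τ) (k : ℕ)
    (H : ∀ c d, f c = some d → Within g k (φ c) (φ d)) {n : ℕ} {c d : σ} (h : Within f n c d) :
    Within g (n * k) (φ c) (φ d) := by
  induction h with
  | refl => exact .refl _ _
  | step hs _ ih => exact ((H _ _ hs).trans ih).mono (by rw [Nat.succ_mul]; omega)

end Within

theorem Cfg.eq_of_fields {Γ : Type} {M : TM Γ} {c d : Cfg M} (hs : c.state = d.state)
    (hh : c.head = d.head) (ht : c.tape = d.tape) : c = d := by
  cases c
  cases d
  simp_all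

/-! ### Runs and halting of Turing machines. -/

namespace TM

variable {Γ : Type} (M : TM Γ)

theorem run_zero (c : Cfg M) : M.run c 0 = c := rfl

theorem run_succ (c : Cfg M) (t : ℕ) : M.run c (t + 1) = M.run ((M.step c).getD c) t := rfl

theorem run_succ' (c : Cfg M) (t : ℕ) :
    M.run c (t + 1) = (M.step (M.run c t)).getD (M.run c t) :=
  Function.iterate_succ_apply' _ _ _

theorem run_add (c : Cfg M) (s t : ℕ) : M.run c (s + t) = M.run (M.run c s) t := by
  unfold run
  rw [Nat.add_comm, Function.iterate_add_apply]

variable {M}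

theorem Halted.run_eq {c : Cfg M} (h : M.Halted c) (t : ℕ) : M.run c t = c := by
  induction t with
  | zero => rfl
  | succ t ih => rw [run_succ, show M.step c = none from h]; exact ih

theorem run_eq_of_halted_of_le {c : Cfg M} {s t : ℕ} (h : M.Halted (M.run c s)) (hst : s ≤ t) :
    M.run c t = M.run c s := by
  obtain ⟨k, rfl⟩ := Nat.exists_eq_add_of_le hst
  rw [run_add, h.run_eq]

theorem AnswersWithin.mono {c : Cfg M} {s t : ℕ} {p : Prop} (h : M.AnswersWithin c s p)
    (hst : s ≤ t) : M.AnswersWithin c t p := by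
  unfold AnswersWithin at *
  rwa [run_eq_of_halted_of_le h.1 hst]

theorem exists_run_eq_of_within {n : ℕ} {c d : Cfg M} (h : Within M.step n c d) :
    ∃ t ≤ n, M.run c t = d := by
  induction h with
  | refl n c => exact ⟨0, Nat.zero_le _, rfl⟩
  | step hs _ ih =>
    obtain ⟨t, ht, hr⟩ := ih
    exact ⟨t + 1, by omega, by rw [run_succ, hs]; exact hr⟩

theorem answersWithin_of_within {n : ℕ} {c d : Cfg M} {p : Prop} (h : Within M.step n c d)
    (hd : M.Halted d) (hp : M.accept d.state = true ↔ p) : M.AnswersWithin c n p := by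
  obtain ⟨t, ht, rfl⟩ := exists_run_eq_of_within h
  exact AnswersWithin.mono ⟨hd, hp⟩ ht

theorem step_eq_some {c d : Cfg M} (h : M.step c = some d) :
    ∃ r, M.δ c.state (c.tape c.head) = some r ∧
      d = ⟨r.1, r.2.2.apply c.head, Function.update c.tape c.head r.2.1⟩ := by
  unfold step at h
  rw [Option.map_eq_some_iff] at h
  obtain ⟨r, hr, rfl⟩ := h
  exact ⟨r, hr, rfl⟩

theorem step_of_δ {c : Cfg M} {q : M.Q} {b : Γ} {m : Move}
    (h : M.δ c.state (c.tape c.head) = some (q, b, m)) :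
    M.step c = some ⟨q, m.apply c.head, Function.update c.tape c.head b⟩ := by
  simp [step, h]

theorem halted_of_δ {c : Cfg M} (h : M.δ c.state (c.tape c.head) = none) : M.Halted c := by
  simp [Halted, step, h]

theorem head_run_le (c : Cfg M) (t : ℕ) : (M.run c t).head ≤ c.head + t := by
  induction t with
  | zero => exact le_rfl
  | succ t ih =>
    rw [run_succ']
    cases h : M.step (M.run c t) with
    | none => simpa using by omega
    | some d =>
      obtain ⟨⟨q, b, m⟩, -, rfl⟩ := step_eq_some h
      cases m <;> simp [Move.apply] <;> omega

/-- A machine that answers within `s` steps scans only the `s + 1` leftmost cells. -/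
theorem AnswersWithin.usesSpace {c : Cfg M} {s : ℕ} {p : Prop} (h : M.AnswersWithin c s p)
    (hc : c.head = 0) : M.UsesSpace c (s + 1) := by
  intro t
  rcases le_total t s with hts | hts
  · have := head_run_le c t
    omega
  · rw [run_eq_of_halted_of_le h.1 hts]
    have := head_run_le c s
    omega

end TM

/-! ### Polynomial time bound for write-once machines in polynomial space. -/

section TimeBound

open TM

variable {M : TM Bool}

theorem TM.IsWriteOnce.tape_mono_step (hM : M.IsWriteOnce) (c : Cfg M) (i : ℕ)
    (hi : c.tape i = true) : ((M.step c).getD c).tape i = true := by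
  cases h : M.step c with
  | none => exact hi
  | some d =>
    obtain ⟨⟨q, b, m⟩, hr, rfl⟩ := step_eq_some h
    simp only [Option.getD_some, Function.update_apply]
    split
    · next hh =>
      subst hh
      rw [hi] at hr
      cases b with
      | true => rfl
      | false => exact absurd hr (hM _ _ _)
    · exact hi

theorem TM.IsWriteOnce.tape_mono (hM : M.IsWriteOnce) (c : Cfg M) {s t : ℕ} (hst : s ≤ t) (i : ℕ)
    (hi : (M.run c s).tape i = true) : (M.run c t).tape i = true := by
  induction t, hst using Nat.le_induction with
  | base => exact hi
  | succ t _ ih => rw [run_succ']; exact hM.tape_mono_step _ _ ih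

theorem TM.UsesSpace.tape_eq {c : Cfg M} {s : ℕ} (hs : M.UsesSpace c s) (t : ℕ) {i : ℕ}
    (hi : s ≤ i) : (M.run c t).tape i = c.tape i := by
  induction t with
  | zero => rfl
  | succ t ih =>
    rw [run_succ', ← ih]
    cases h : M.step (M.run c t) with
    | none => rfl
    | some d =>
      obtain ⟨r, -, rfl⟩ := step_eq_some h
      have := hs t
      exact Function.update_of_ne (by omega) _ _

/-- A halting write-once machine that scans at most `s` cells halts after at most
`|Q| * (s * (s + 1))` steps: state, head position and number of marked cells do not recur. -/
theorem TM.IsWriteOnce.halted_run (hM : M.IsWriteOnce) {c : Cfg M} {s : ℕ}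
    (hs : M.UsesSpace c s) (hh : ∃ t, M.Halted (M.run c t)) :
    M.Halted (M.run c (letI := M.finQ; Fintype.card M.Q * (s * (s + 1)))) := by
  classical
  let _ := M.finQ
  let T := Nat.find hh
  have hT : M.Halted (M.run c T) := Nat.find_spec hh
  let marked : ℕ → Finset ℕ := fun t => (Finset.range s).filter fun i => (M.run c t).tape i = true
  have hmarked : ∀ t, (marked t).card < s + 1 := fun t =>
    Nat.lt_succ_of_le ((Finset.card_filter_le _ _).trans (Finset.card_range s).le)
  let φ : Fin T → M.Q × Fin s × Fin (s + 1) := fun t =>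
    ((M.run c t).state, ⟨(M.run c t).head, hs t⟩, ⟨(marked t).card, hmarked t⟩)
  have key : ∀ i j : Fin T, i < j → φ i ≠ φ j := by
    intro i j hij he
    simp only [φ, Prod.mk.injEq, Fin.mk.injEq] at he
    obtain ⟨h1, h2, h3⟩ := he
    have hij' : (i : ℕ) ≤ j := hij.le
    have hsub : marked i ⊆ marked j := fun x hx => by
      simp only [marked, Finset.mem_filter] at hx ⊢
      exact ⟨hx.1, hM.tape_mono c hij' x hx.2⟩
    -- Here write-once matters: the sets of marked cells are nested, so equal cardinality forces
    -- equality.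
    have hmk := Finset.eq_of_subset_of_card_le hsub h3.ge
    have htape : (M.run c i).tape = (M.run c j).tape := by
      funext x
      by_cases hx : x < s
      · have := Finset.ext_iff.1 hmk x
        simp only [marked, Finset.mem_filter, Finset.mem_range, hx, true_and] at this
        exact Bool.eq_iff_iff.2 this
      · rw [hs.tape_eq _ (by omega), hs.tape_eq _ (by omega)]
    have hcfg : M.run c i = M.run c j := by
      cases hi : M.run c i
      cases hj : M.run c j
      simp only [hi, hj] at h1 h2 htape
      simp [h1, h2, htape]
    have hjT := j.2
    have hlt : (i : ℕ) < j := hij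
    -- Cutting out the loop between `i` and `j` would give a halting time smaller than the minimal
    -- one.
    have : M.Halted (M.run c (i + (T - j))) := by
      rw [run_add, hcfg, ← run_add, show (j : ℕ) + (T - j) = T by omega]
      exact hT
    exact Nat.find_min hh (m := i + (T - j)) (by change _ < T; omega) this
  have hinj : Function.Injective φ := by
    intro i j he
    rcases lt_trichotomy i j with h | h | h
    · exact absurd he (key _ _ h)
    · exact h
    · exact absurd he.symm (key _ _ h)
  have hcard := Fintype.card_le_of_injective φ hinj
  simp only [Fintype.card_fin, Fintype.card_prod] at hcard
  rw [run_eq_of_halted_of_le hT hcard]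
  exact hT

end TimeBound

/-! ### Packing two cells into one: `DWOPSpace ⊆ P`. -/

section TwoCells

open TM

/-- The simulation of a machine over `Bool` by a machine with two of its cells in each cell; a
mark written in the first step identifies the leftmost cell. -/
def TM.packed (M : TM Bool) : TM (Bool × Bool × Bool) where
  Q := Option (M.Q × Bool)
  finQ := letI := M.finQ; inferInstance
  start := none
  accept s := s.elim false fun r => M.accept r.1
  δ s a := match s with
    | none => some (some (M.start, false), (true, a.2), .stay)
    | some (q, false) => (M.δ q a.2.1).map fun r =>
        match r.2.2 with
        | .right => (some (r.1, true), (a.1, r.2.1, a.2.2), .stay)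
        | .stay => (some (r.1, false), (a.1, r.2.1, a.2.2), .stay)
        | .left => if a.1 then (some (r.1, false), (a.1, r.2.1, a.2.2), .stay)
            else (some (r.1, true), (a.1, r.2.1, a.2.2), .left)
    | some (q, true) => (M.δ q a.2.2).map fun r =>
        match r.2.2 with
        | .right => (some (r.1, false), (a.1, a.2.1, r.2.1), .right)
        | .stay => (some (r.1, true), (a.1, a.2.1, r.2.1), .stay)
        | .left => (some (r.1, false), (a.1, a.2.1, r.2.1), .stay)

variable {M : TM Bool}

/-- The packed configuration that represents a configuration. -/
def Cfg.packed (c : Cfg M) : Cfg M.packed where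
  state := some (c.state, decide (c.head % 2 = 1))
  head := c.head / 2
  tape i := (decide (i = 0), c.tape (2 * i), c.tape (2 * i + 1))

/-- The parity of the head position sits in the state, so a move either flips the parity inside a
packed cell or crosses to a neighbour. At even positions a left move needs the mark of the leftmost
cell, to know when to stay. As an equation of options it covers halting too. -/
theorem TM.step_packed (c : Cfg M) : M.packed.step c.packed = (M.step c).map Cfg.packed := by
  obtain ⟨q, h, T⟩ := c
  have htape (x y : Bool) (k : ℕ) (b : Bool)
      (hxy : h = 2 * k ∧ x = b ∧ y = T (2 * k + 1) ∨ h = 2 * k + 1 ∧ x = T (2 * k) ∧ y = b) :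
      Function.update (fun i => (decide (i = 0), T (2 * i), T (2 * i + 1))) k
        (decide (k = 0), x, y) = fun i => (decide (i = 0),
          Function.update T h b (2 * i), Function.update T h b (2 * i + 1)) := by
    funext i
    by_cases hi : i = k
    · subst hi
      obtain ⟨rfl, rfl, rfl⟩ | ⟨rfl, rfl, rfl⟩ := hxy <;> simp
    · rw [Function.update_of_ne hi, Function.update_of_ne (by omega),
        Function.update_of_ne (by omega)]
  cases hδ : M.δ q (T h) with
  | none =>
    rw [show M.step ⟨q, h, T⟩ = none from halted_of_δ hδ]
    refine halted_of_δ ?_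
    obtain ⟨k, rfl | rfl⟩ : ∃ k, h = 2 * k ∨ h = 2 * k + 1 := ⟨h / 2, by omega⟩
    · simp [TM.packed, Cfg.packed, hδ]
    · have e1 : (2 * k + 1) / 2 = k := by omega
      have e2 : (2 * k + 1) % 2 = 1 := by omega
      simp [TM.packed, Cfg.packed, hδ, e1, e2]
  | some r =>
    obtain ⟨q', b, m⟩ := r
    rw [step_of_δ (c := (⟨q, h, T⟩ : Cfg M)) hδ, Option.map_some]
    have fin (p : Bool) (m' : Move) (x y : Bool)
        (hp : p = decide (m.apply h % 2 = 1)) (hm : m'.apply (h / 2) = m.apply h / 2)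
        (hxy : h % 2 = 0 ∧ x = b ∧ y = T (2 * (h / 2) + 1) ∨
          h % 2 = 1 ∧ x = T (2 * (h / 2)) ∧ y = b)
        (hs : M.packed.δ (some (q, decide (h % 2 = 1)))
          (decide (h / 2 = 0), T (2 * (h / 2)), T (2 * (h / 2) + 1)) =
            some (some (q', p), (decide (h / 2 = 0), x, y), m')) :
        M.packed.step (Cfg.packed ⟨q, h, T⟩) =
          some (Cfg.packed ⟨q', m.apply h, Function.update T h b⟩) := by
      subst hp
      rw [step_of_δ (c := Cfg.packed ⟨q, h, T⟩) hs]
      simp only [Cfg.packed, hm]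
      rw [htape _ _ _ b (hxy.imp (fun H => ⟨by omega, H.2⟩) fun H => ⟨by omega, H.2⟩)]
    have hpar : h % 2 = 0 ∨ h % 2 = 1 := by omega
    rcases hpar with h2 | h2
    · have hT : T (2 * (h / 2)) = T h := by congr 1; omega
      cases m with
      | right =>
        refine fin true .stay b _ ?_ ?_ (.inl ⟨h2, rfl, rfl⟩) ?_
        · simp only [Move.apply]; exact (decide_eq_true (by omega)).symm
        · simp only [Move.apply]; omega
        · simp [TM.packed, h2, hT, hδ]
      | stay =>
        refine fin false .stay b _ ?_ ?_ (.inl ⟨h2, rfl, rfl⟩) ?_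
        · simp [Move.apply, h2]
        · rfl
        · simp [TM.packed, h2, hT, hδ]
      | left =>
        by_cases h0 : h / 2 = 0
        · refine fin false .stay b _ ?_ ?_ (.inl ⟨h2, rfl, rfl⟩) ?_
          · simp only [Move.apply]; exact (decide_eq_false (by omega)).symm
          · simp only [Move.apply]; omega
          · have : T 0 = T h := by congr 1; omega
            simp [TM.packed, h2, hδ, h0, this]
        · refine fin true .left b _ ?_ ?_ (.inl ⟨h2, rfl, rfl⟩) ?_
          · simp only [Move.apply]; exact (decide_eq_true (by omega)).symm
          · simp only [Move.apply]; omega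
          · rw [decide_eq_false h0]; simp [TM.packed, h2, hT, hδ]
    · have hT : T (2 * (h / 2) + 1) = T h := by congr 1; omega
      cases m with
      | right =>
        refine fin false .right _ b ?_ ?_ (.inr ⟨h2, rfl, rfl⟩) ?_
        · simp only [Move.apply]; exact (decide_eq_false (by omega)).symm
        · simp only [Move.apply]; omega
        · simp [TM.packed, h2, hT, hδ]
      | stay =>
        refine fin true .stay _ b ?_ ?_ (.inr ⟨h2, rfl, rfl⟩) ?_
        · simp [Move.apply, h2]
        · rfl
        · simp [TM.packed, h2, hT, hδ]
      | left =>
        refine fin false .stay _ b ?_ ?_ (.inr ⟨h2, rfl, rfl⟩) ?_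
        · simp only [Move.apply]; exact (decide_eq_false (by omega)).symm
        · simp only [Move.apply]; omega
        · simp [TM.packed, h2, hT, hδ]

theorem TM.run_packed (c : Cfg M) (t : ℕ) :
    M.packed.run c.packed t = (M.run c t).packed := by
  induction t generalizing c with
  | zero => rfl
  | succ t ih =>
    rw [run_succ, run_succ, step_packed]
    cases h : M.step c with
    | none => exact ih c
    | some d => exact ih d

theorem getD_encode (w : List Bool) (i : ℕ) :
    (encode w).getD (2 * i) false = ((w.map fun b => (b, !b)).getD i (false, false)).1 ∧
    (encode w).getD (2 * i + 1) false = ((w.map fun b => (b, !b)).getD i (false, false)).2 := by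
  induction w generalizing i with
  | nil => simp [encode]
  | cons b w ih =>
    cases i with
    | zero => simp [encode]
    | succ i =>
      have := ih i
      simpa [encode, Nat.mul_succ] using this

/-- The extra first step writes the mark on the leftmost cell, which the presentation of the input
does not provide. -/
theorem TM.run_packed_init (w : List Bool) (t : ℕ) :
    M.packed.run (M.packed.init (false, false, false) (w.map fun b => (false, b, !b))) (1 + t) =
      (M.run (M.init false (encode w)) t).packed := by
  rw [run_add, ← run_packed]
  congr 1
  rw [show (1 : ℕ) = 0 + 1 from rfl, run_succ, run_zero, step_of_δ (M := M.packed) rfl,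
    Option.getD_some]
  refine Cfg.eq_of_fields rfl (by simp [TM.init, Cfg.packed, Move.apply]) ?_
  simp only [TM.init, Cfg.packed]
  funext i
  rw [(getD_encode w i).1, (getD_encode w i).2]
  cases i with
  | zero => cases w <;> simp
  | succ i =>
    rw [Function.update_of_ne (by omega)]
    simp only [List.getD_eq_getElem?_getD, List.getElem?_map]
    cases w[i + 1]? <;> simp

theorem DWOPSpace_subset_P : DWOPSpace ⊆ P := by
  rintro L ⟨M, p, hM, h⟩
  let _ := M.finQ
  refine ⟨Bool × Bool × Bool, inferInstance, (false, false, false), fun b => (false, b, !b),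
    M.packed, 1 + Polynomial.C (Fintype.card M.Q) * (p * (p + 1)), ?_, ?_, ?_⟩
  · intro a b hab
    simp only [Prod.mk.injEq] at hab
    exact hab.2.1
  · intro b hb
    cases b <;> simp at hb
  · intro w
    obtain ⟨⟨t, ht⟩, hs⟩ := h w
    have hH := hM.halted_run hs ⟨t, ht.1⟩
    simp only [Polynomial.eval_add, Polynomial.eval_mul, Polynomial.eval_one, Polynomial.eval_C]
    set T := Fintype.card M.Q * (p.eval w.length * (p.eval w.length + 1))
    -- The given halting time `t` is not bounded by any polynomial; the halting configuration is the
    -- same at time `T`, which is.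
    have hTt : M.run (M.init false (encode w)) T = M.run (M.init false (encode w)) t := by
      rcases le_total t T with h1 | h1
      · exact run_eq_of_halted_of_le ht.1 h1
      · exact (run_eq_of_halted_of_le hH h1).symm
    unfold AnswersWithin
    rw [run_packed_init, hTt]
    refine ⟨?_, ht.2⟩
    unfold Halted
    rw [step_packed, show M.step _ = none from ht.1]
    rfl

end TwoCells

theorem TM.step_eq_of_δ {Γ : Type} {M : TM Γ} {c d : Cfg M} {b : Γ} {m : Move}
    (h : M.δ c.state (c.tape c.head) = some (d.state, b, m)) (hh : d.head = m.apply c.head)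
    (ht : d.tape = Function.update c.tape c.head b) : M.step c = some d := by
  rw [step_of_δ h]
  exact congrArg some (Cfg.eq_of_fields rfl hh.symm ht.symm)

/-! ### From monotone machines over pairs of cells to write-once machines. -/

section Unpacking

open TM

instance : Fintype Move := ⟨⟨([.left, .right, .stay] : List Move), by simp⟩, fun m => by cases m <;> simp⟩

/-- No transition of a machine over pairs of cells writes a blank to a marked cell. -/
def TM.IsMonotone (N : TM (Bool × Bool)) : Prop :=
  ∀ q a q' b m, N.δ q a = some (q', b, m) → (a.1 = true → b.1 = true) ∧ (a.2 = true → b.2 = true)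

/-- The simulation of a machine over pairs of cells by a write-once machine over single cells:
read the two cells, then write them and move twice. -/
def TM.unpacked (N : TM (Bool × Bool)) : TM Bool where
  Q := N.Q ⊕ (N.Q × Bool) ⊕ (N.Q × Bool × Move) ⊕ (N.Q × Move)
  finQ := letI := N.finQ; inferInstance
  start := .inl N.start
  accept s := match s with
    | .inr (.inl (q, _)) => N.accept q
    | _ => false
  δ s y := match s with
    | .inl q => some (.inr (.inl (q, y)), y, .right)
    | .inr (.inl (q, x)) => (N.δ q (x, y)).map fun r =>
        (.inr (.inr (.inl (r.1, r.2.1.1, r.2.2))), y || r.2.1.2, .left)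
    | .inr (.inr (.inl (q, x, m))) => some (.inr (.inr (.inr (q, m))), y || x, m)
    | .inr (.inr (.inr (q, m))) => some (.inl q, y, m)

theorem TM.isWriteOnce_unpacked (N : TM (Bool × Bool)) : N.unpacked.IsWriteOnce := by
  rintro (q | ⟨q, x⟩ | ⟨q, x, m⟩ | ⟨q, m⟩) q' m' h <;>
  · have h' := congrArg (Option.map fun r => r.2.1) h
    -- Every symbol written is `y` or a disjunction with `y`, the symbol read, so `y = true` is
    -- preserved whatever `N` does.
    simp [TM.unpacked] at h'

variable {N : TM (Bool × Bool)}

/-- The tape of single cells that represents a tape of pairs. -/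
def unpackTape (T : ℕ → Bool × Bool) (i : ℕ) : Bool :=
  if i % 2 = 0 then (T (i / 2)).1 else (T (i / 2)).2

theorem unpackTape_even (T : ℕ → Bool × Bool) (i : ℕ) : unpackTape T (2 * i) = (T i).1 := by
  simp [unpackTape]

theorem unpackTape_odd (T : ℕ → Bool × Bool) (i : ℕ) : unpackTape T (2 * i + 1) = (T i).2 := by
  have : (2 * i + 1) / 2 = i := by omega
  simp [unpackTape, this]

theorem unpackTape_update (T : ℕ → Bool × Bool) (h : ℕ) (b : Bool × Bool) :
    unpackTape (Function.update T h b) =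
      Function.update (Function.update (unpackTape T) (2 * h + 1) b.2) (2 * h) b.1 := by
  funext i
  by_cases hi : i / 2 = h
  · obtain rfl | rfl : i = 2 * h ∨ i = 2 * h + 1 := by omega
    · simp [unpackTape_even]
    · simp [unpackTape_odd]
  · rw [Function.update_of_ne (by omega), Function.update_of_ne (by omega), unpackTape,
      unpackTape, Function.update_of_ne hi]

/-- The unpacked configuration that represents a configuration over pairs. -/
def Cfg.unpacked (c : Cfg N) : Cfg N.unpacked where
  state := .inl c.state
  head := 2 * c.head
  tape := unpackTape c.tape

theorem TM.step_unpacked (c : Cfg N) : N.unpacked.step c.unpacked =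
    some ⟨.inr (.inl (c.state, (c.tape c.head).1)), 2 * c.head + 1, unpackTape c.tape⟩ := by
  refine step_eq_of_δ (b := (c.tape c.head).1) (m := .right) ?_ rfl ?_
  · simp [TM.unpacked, Cfg.unpacked, unpackTape_even]
  · rw [← unpackTape_even]
    exact (Function.update_eq_self _ _).symm

/-- The disjunctions that make the machine write-once do not alter the result, because monotonicity
gives `old || new = new` in both components. -/
theorem TM.within_unpacked (hN : N.IsMonotone) (c d : Cfg N) (h : N.step c = some d) :
    Within N.unpacked.step 4 c.unpacked d.unpacked := by
  obtain ⟨⟨q, ⟨x, y⟩, m⟩, hδ, rfl⟩ := step_eq_some h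
  obtain ⟨hx, hy⟩ := hN _ _ _ _ _ hδ
  have hx' : ((c.tape c.head).1 || x) = x := by revert hx; cases (c.tape c.head).1 <;> simp
  have hy' : ((c.tape c.head).2 || y) = y := by revert hy; cases (c.tape c.head).2 <;> simp
  refine .step (step_unpacked c) (.step (c' := ⟨.inr (.inr (.inl (q, x, m))), 2 * c.head,
    Function.update (unpackTape c.tape) (2 * c.head + 1) y⟩) ?_
    (.step (c' := ⟨.inr (.inr (.inr (q, m))), m.apply (2 * c.head),
      unpackTape (Function.update c.tape c.head (x, y))⟩) ?_ (.single ?_)))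
  · refine step_eq_of_δ (b := y) (m := .left) ?_ rfl rfl
    simp [TM.unpacked, unpackTape_odd, hδ, hy']
  · refine step_eq_of_δ (b := x) (m := m) ?_ rfl ?_
    · simp [TM.unpacked, unpackTape_even, hx']
    · rw [unpackTape_update]
  · refine step_eq_of_δ (m := m) rfl ?_ (Function.update_eq_self _ _).symm
    -- Two left moves from cell `2 * h` reach `2 * (h - 1)` also for `h = 0`, by truncated
    -- subtraction.
    cases m <;> simp [Cfg.unpacked, Move.apply] <;> omega

/-- Halting shows only once both components are known, so one more step is made, to the second cell
of the pair. -/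
theorem TM.within_unpacked_halted {c : Cfg N} (h : N.Halted c) :
    ∃ d, Within N.unpacked.step 1 c.unpacked d ∧ N.unpacked.Halted d ∧
      N.unpacked.accept d.state = N.accept c.state := by
  refine ⟨_, .single (step_unpacked c), halted_of_δ ?_, rfl⟩
  have : N.δ c.state (c.tape c.head) = none := by simpa [Halted, step] using h
  simp [TM.unpacked, unpackTape_odd, this]

/-- What a monotone machine over pairs answers, a write-once machine answers in four times the
number of steps. -/
theorem TM.IsMonotone.answersWithin_unpacked (hN : N.IsMonotone) {c d : Cfg N} {n : ℕ} {p : Prop}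
    (h : Within N.step n c d) (hd : N.Halted d) (hp : N.accept d.state = true ↔ p) :
    N.unpacked.AnswersWithin c.unpacked (n * 4 + 1) p := by
  obtain ⟨e, he, heh, hea⟩ := within_unpacked_halted hd
  exact answersWithin_of_within ((h.simulate _ 4 (within_unpacked hN)).trans he) heh (hea ▸ hp)

end Unpacking

/-! ### Queue machines and their simulation on a write-once tape. -/

/-- A machine with a finite control and a queue of bits. In each step it removes the front entry of
the queue and appends a list of bits. Initially the queue holds the input followed by a separator
`none`; `raw` tells the states in which the separator is still in the queue. -/
structure QueueMachine where
  /-- the states -/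
  S : Type
  [finS : Finite S]
  /-- the initial state -/
  start : S
  /-- the accepting states -/
  accept : S → Bool
  /-- the states in which the input has not been read completely -/
  raw : S → Bool
  /-- the transition function -/
  δ : S → Option Bool → Option (S × List Bool)
  /-- the largest number of bits that are appended in one step -/
  bound : ℕ
  raw_start : raw start = true
  length_le : ∀ s x r, δ s x = some r → r.2.length ≤ bound
  raw_some : ∀ s b r, δ s (some b) = some r → raw r.1 = raw s
  raw_none : ∀ s r, δ s none = some r → raw r.1 = false

namespace QueueMachine

open TM

variable (Q : QueueMachine)

/-- One step of a queue machine. -/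
def step (c : Q.S × List (Option Bool)) : Option (Q.S × List (Option Bool)) :=
  (Q.δ c.1 c.2.head?.join).map fun r => (r.1, c.2.tail ++ r.2.map some)

/-- A queue contains the separator exactly once if the input is still being read, and does not
contain it otherwise. -/
def WellFormed (raw : Bool) (X : List (Option Bool)) : Prop :=
  match raw with
  | true => ∃ r q, none ∉ r ∧ none ∉ q ∧ X = r ++ none :: q
  | false => none ∉ X

/-- The pair of cells that represents an entry of the queue. -/
def pair : Option Bool → Bool × Bool
  | none => (false, false)
  | some b => (b, !b)

/-- The entry of the queue that is represented by a pair of cells. -/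
def unpair (x : Bool × Bool) : Option Bool :=
  if x = (false, false) then none else some x.1

theorem unpair_pair (x : Option Bool) : unpair (pair x) = x := by
  rcases x with _ | _ | _ <;> rfl

theorem pair_ne_marked (x : Option Bool) : pair x ≠ (true, true) := by
  rcases x with _ | _ | _ <;> simp [pair]

theorem pair_eq_blank {x : Option Bool} (h : pair x = (false, false)) : x = none := by
  rw [← unpair_pair x, h]; rfl

/-- The tape of pairs on which `a` entries have been removed from a queue and `X` is left. -/
def tape (a : ℕ) (X : List (Option Bool)) (i : ℕ) : Bool × Bool :=
  if i < a then (true, true) else pair (X.getD (i - a) none)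

theorem tape_of_lt {a i : ℕ} (X : List (Option Bool)) (h : i < a) : tape a X i = (true, true) :=
  if_pos h

theorem tape_ne_marked {a i : ℕ} (X : List (Option Bool)) (h : a ≤ i) :
    tape a X i ≠ (true, true) := by
  rw [tape, if_neg (by omega)]
  exact pair_ne_marked _

theorem tape_ne_blank {a i : ℕ} {X : List (Option Bool)}
    (h : a ≤ i → ∃ b, X[i - a]? = some (some b)) : tape a X i ≠ (false, false) := by
  unfold tape
  split
  · simp
  · obtain ⟨b, hb⟩ := h (by omega)
    intro h'
    have := pair_eq_blank h'
    simp [List.getD_eq_getElem?_getD, hb] at this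

/-- With `join` this covers both the separator and the cells beyond the queue; on the tape they look
alike, which is why the simulation needs a flag. -/
theorem tape_eq_blank {a i : ℕ} {X : List (Option Bool)} (h : a ≤ i)
    (hX : X[i - a]?.join = none) : tape a X i = (false, false) := by
  rw [tape, if_neg (by omega), List.getD_eq_getElem?_getD]
  revert hX
  rcases X[i - a]? with _ | _ | _ <;> simp [pair]

theorem unpair_tape (a : ℕ) (X : List (Option Bool)) : unpair (tape a X a) = X.head?.join := by
  rw [tape, if_neg (by omega), unpair_pair]
  rcases X with _ | ⟨_ | _, _⟩ <;> simp

theorem update_tape_front (a : ℕ) (X : List (Option Bool)) :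
    Function.update (tape a X) a (true, true) = tape (a + 1) X.tail := by
  funext i
  rcases lt_trichotomy i a with h | rfl | h
  · rw [Function.update_of_ne h.ne, tape_of_lt _ h, tape_of_lt _ (by omega)]
  · rw [Function.update_self, tape_of_lt _ (by omega)]
  · rw [Function.update_of_ne h.ne', tape, tape, if_neg (by omega), if_neg (by omega)]
    obtain ⟨k, rfl⟩ : ∃ k, i = a + 1 + k := ⟨i - (a + 1), by omega⟩
    rw [show a + 1 + k - a = k + 1 by omega, show a + 1 + k - (a + 1) = k by omega]
    cases X <;> simp

theorem update_tape_back (a : ℕ) (X : List (Option Bool)) (b : Bool) :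
    Function.update (tape a X) (a + X.length) (b, !b) = tape a (X ++ [some b]) := by
  funext i
  rcases eq_or_ne i (a + X.length) with rfl | h
  · rw [Function.update_self, tape, if_neg (by omega)]
    simp [pair]
  · rw [Function.update_of_ne h]
    unfold tape
    split
    · rfl
    · congr 1
      simp only [List.getD_eq_getElem?_getD]
      rcases lt_or_ge (i - a) X.length with h' | h'
      · rw [List.getElem?_append_left h']
      · rw [List.getElem?_eq_none h', List.getElem?_eq_none (by simp; omega)]

/-- The simulation of a queue machine by a machine over pairs of cells. In a state `inl s`, the head
is on the front entry of the queue. In a state `inr (s, l, f)`, the bits `l` remain to be appended,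
and `f` tells whether the separator has yet to be skipped. -/
noncomputable def toTM : TM (Bool × Bool) where
  Q := Q.S ⊕ (Q.S × {l : List Bool // l.length ≤ Q.bound} × Bool)
  finQ :=
    have := Q.finS
    have : Finite {l : List Bool // l.length ≤ Q.bound} := List.finite_length_le Bool Q.bound
    Fintype.ofFinite _
  start := .inl Q.start
  accept s := s.elim Q.accept fun _ => false
  δ s x := match s with
    | .inl s => (Q.δ s (unpair x)).map fun r =>
        (.inr (r.1, ⟨r.2.take Q.bound, List.length_take_le _ _⟩, Q.raw r.1), (true, true), .stay)
    | .inr (s, ⟨[], h⟩, f) =>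
        if x = (true, true) then some (.inl s, x, .right) else some (.inr (s, ⟨[], h⟩, f), x, .left)
    | .inr (s, ⟨b :: l, h⟩, f) =>
        if x = (false, false) then
          if f then some (.inr (s, ⟨b :: l, h⟩, false), x, .right)
          else some (.inr (s, ⟨l, (Nat.le_succ _).trans h⟩, false), (b, !b), .stay)
        else some (.inr (s, ⟨b :: l, h⟩, f), x, .right)

/-- A pair is either marked completely, left as it is, or overwritten when it is blank. -/
theorem isMonotone_toTM : Q.toTM.IsMonotone := by
  rintro (s | ⟨s, ⟨_ | ⟨b, l⟩, hl⟩, f⟩) ⟨x, y⟩ q' b' m h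
  · obtain ⟨r, -, h⟩ := Option.map_eq_some_iff.1 h
    have hb : (true, true) = b' := congrArg (fun r => r.2.1) h
    simp [← hb]
  · simp only [toTM] at h
    split at h <;>
    · have hb : (x, y) = b' := congrArg (fun r => r.2.1) (Option.some.inj h)
      simp [← hb]
  · simp only [toTM] at h
    split at h
    · next hx => simp_all
    · have hb : (x, y) = b' := congrArg (fun r => r.2.1) (Option.some.inj h)
      simp [← hb]

variable {Q}

theorem within_right {s : Q.S} {b : Bool} {l : List Bool} {hl : (b :: l).length ≤ Q.bound} {f : Bool}
    {T : ℕ → Bool × Bool} {d h : ℕ} (hT : ∀ i < d, T (h + i) ≠ (false, false)) :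
    Within Q.toTM.step d ⟨.inr (s, ⟨b :: l, hl⟩, f), h, T⟩
      ⟨.inr (s, ⟨b :: l, hl⟩, f), h + d, T⟩ := by
  induction d generalizing h with
  | zero => exact .refl _ _
  | succ d ih =>
    refine .step (c' := ⟨.inr (s, ⟨b :: l, hl⟩, f), h + 1, T⟩) ?_ ?_
    · refine step_eq_of_δ (b := T h) (m := .right) ?_ rfl (Function.update_eq_self _ _).symm
      exact if_neg (hT 0 (by omega))
    · rw [show h + (d + 1) = h + 1 + d by omega]
      exact ih fun i hi => by
        rw [show h + 1 + i = h + (i + 1) by omega]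
        exact hT _ (by omega)

theorem within_left {s : Q.S} {hl : ([] : List Bool).length ≤ Q.bound} {f : Bool}
    {T : ℕ → Bool × Bool} {d h : ℕ} (hT : ∀ i < d, T (h + i + 1) ≠ (true, true)) :
    Within Q.toTM.step d ⟨.inr (s, ⟨[], hl⟩, f), h + d, T⟩ ⟨.inr (s, ⟨[], hl⟩, f), h, T⟩ := by
  induction d with
  | zero => exact .refl _ _
  | succ d ih =>
    refine .step (c' := ⟨.inr (s, ⟨[], hl⟩, f), h + d, T⟩) ?_ (ih fun i hi => hT i (by omega))
    refine step_eq_of_δ (b := T (h + d + 1)) (m := .left) ?_ rfl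
      (Function.update_eq_self _ _).symm
    exact if_neg (hT d (by omega))

/-- By `hX` the first blank pair from `h` on is the end of the queue. The head stays on the pair
just written, so for the next bit the induction starts from there. -/
theorem within_append (s : Q.S) (l : List Bool) (hl : l.length ≤ Q.bound) (a : ℕ)
    (X : List (Option Bool)) (h : ℕ) (h₁ : a ≤ h) (h₂ : h ≤ a + 1 + X.length)
    (hX : ∀ i, h ≤ i → i < a + 1 + X.length → tape (a + 1) X i ≠ (false, false)) :
    ∃ h', a ≤ h' ∧ h' ≤ a + 1 + X.length + l.length ∧
      Within Q.toTM.step (l.length * (X.length + l.length + 2))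
        ⟨.inr (s, ⟨l, hl⟩, false), h, tape (a + 1) X⟩
        ⟨.inr (s, ⟨[], Nat.zero_le _⟩, false), h', tape (a + 1) (X ++ l.map some)⟩ := by
  induction l generalizing X h with
  | nil => exact ⟨h, h₁, h₂, by simpa using .refl _ _⟩
  | cons b l ih =>
    obtain ⟨h', h₁', h₂', hw⟩ := ih ((Nat.le_succ _).trans hl) (X ++ [some b]) (a + 1 + X.length)
      (by omega) (by simp) (by
        intro i hi hi'
        simp only [List.length_append, List.length_singleton] at hi'
        obtain rfl : i = a + 1 + X.length := by omega
        exact tape_ne_blank fun _ => ⟨b, by simp⟩)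
    simp only [List.length_append, List.length_singleton, List.append_assoc,
      List.singleton_append] at hw h₂'
    refine ⟨h', h₁', by simp; omega, ?_⟩
    obtain ⟨d, hd⟩ := Nat.exists_eq_add_of_le h₂
    have hr : Within Q.toTM.step d ⟨.inr (s, ⟨b :: l, hl⟩, false), h, tape (a + 1) X⟩
        ⟨.inr (s, ⟨b :: l, hl⟩, false), h + d, tape (a + 1) X⟩ :=
      within_right fun i hi => hX _ (by omega) (by omega)
    rw [← hd] at hr
    have hs : Q.toTM.step ⟨.inr (s, ⟨b :: l, hl⟩, false), a + 1 + X.length, tape (a + 1) X⟩ =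
        some ⟨.inr (s, ⟨l, (Nat.le_succ _).trans hl⟩, false), a + 1 + X.length,
          tape (a + 1) (X ++ [some b])⟩ := by
      refine step_eq_of_δ (b := (b, !b)) (m := .stay) ?_ rfl (update_tape_back _ _ _).symm
      exact if_pos (tape_eq_blank (a := a + 1) (i := a + 1 + X.length) (by omega) (by simp))
    refine ((hr.trans (.single hs)).trans hw).mono ?_
    rw [List.length_cons, Nat.succ_mul, show X.length + 1 + l.length + 2 =
      X.length + (l.length + 1) + 2 by omega]
    omega

theorem getElem?_of_none_notMem {X : List (Option Bool)} (hX : none ∉ X) {i : ℕ}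
    (hi : i < X.length) : ∃ b, X[i]? = some (some b) := by
  have h1 := List.getElem_mem hi
  rw [List.getElem?_eq_getElem hi]
  cases h : X[i] with
  | none => rw [h] at h1; exact absurd h1 hX
  | some b => exact ⟨b, rfl⟩

/-- While the input is being read, the separator is a blank pair inside the queue, followed by bits
appended earlier. The first blank pair met is therefore skipped, and the second is the end. If
nothing is to be appended, the head does not move and the flag stays set; hence the unspecified
`f'`. -/
theorem within_append_of_wellFormed (s : Q.S) (l : List Bool) (hl : l.length ≤ Q.bound) (a : ℕ)
    (X : List (Option Bool)) (f : Bool) (hX : WellFormed f X) :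
    ∃ h' f', a ≤ h' ∧ h' ≤ a + 1 + X.length + l.length ∧
      Within Q.toTM.step ((l.length + 1) * (X.length + l.length + 2))
        ⟨.inr (s, ⟨l, hl⟩, f), a, tape (a + 1) X⟩
        ⟨.inr (s, ⟨[], Nat.zero_le _⟩, f'), h', tape (a + 1) (X ++ l.map some)⟩ := by
  rw [Nat.succ_mul]
  cases f with
  | false =>
    obtain ⟨h', h₁, h₂, hw⟩ := within_append s l hl a X a le_rfl (by omega) fun i _ hi =>
      tape_ne_blank fun hi' => getElem?_of_none_notMem hX (by omega)
    exact ⟨h', false, h₁, h₂, hw.mono (by omega)⟩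
  | true =>
    obtain ⟨r, q, hr, hq, rfl⟩ := hX
    cases l with
    | nil => exact ⟨a, true, le_rfl, by omega, by simpa using .refl _ _⟩
    | cons b l =>
      have hlen : (r ++ none :: q).length = r.length + 1 + q.length := by simp; omega
      obtain ⟨h', h₁, h₂, hw⟩ := within_append s (b :: l) hl a (r ++ none :: q)
        (a + (r.length + 1) + 1) (by omega) (by omega) fun i hi hi' =>
          tape_ne_blank fun _ => by
            obtain ⟨k, rfl⟩ := Nat.exists_eq_add_of_le hi
            rw [List.getElem?_append_right (by omega),
              show a + (r.length + 1) + 1 + k - (a + 1) - r.length = k + 1 by omega,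
              List.getElem?_cons_succ]
            exact getElem?_of_none_notMem hq (by omega)
      refine ⟨h', false, h₁, h₂, ?_⟩
      have h1 : Within Q.toTM.step (r.length + 1)
          ⟨.inr (s, ⟨b :: l, hl⟩, true), a, tape (a + 1) (r ++ none :: q)⟩
          ⟨.inr (s, ⟨b :: l, hl⟩, true), a + (r.length + 1), tape (a + 1) (r ++ none :: q)⟩ :=
        within_right fun i hi => tape_ne_blank fun hi' => by
          rw [List.getElem?_append_left (by omega)]
          exact getElem?_of_none_notMem hr (by omega)
      have h2 : Q.toTM.step
          ⟨.inr (s, ⟨b :: l, hl⟩, true), a + (r.length + 1), tape (a + 1) (r ++ none :: q)⟩ =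
          some ⟨.inr (s, ⟨b :: l, hl⟩, false), a + (r.length + 1) + 1,
            tape (a + 1) (r ++ none :: q)⟩ := by
        refine step_eq_of_δ (b := tape (a + 1) (r ++ none :: q) (a + (r.length + 1)))
          (m := .right) ?_ rfl (Function.update_eq_self _ _).symm
        refine (if_pos (tape_eq_blank (a := a + 1) (i := a + (r.length + 1)) (by omega) ?_)).trans (if_pos rfl)
        rw [show a + (r.length + 1) - (a + 1) = r.length by omega]
        simp
      exact ((h1.trans (.single h2)).trans hw).mono (by omega)

/-- The configuration of the simulating machine over pairs after `a` entries have been removed. -/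
def toCfg (a : ℕ) (c : Q.S × List (Option Bool)) : Cfg Q.toTM := ⟨.inl c.1, a, tape a c.2⟩

/-- In a raw state the queue contains the separator, so it is not empty and reading `none` really
removes the separator; in other states `none` can only come from an empty queue. -/
theorem wellFormed_tail {s : Q.S} {X : List (Option Bool)} {r : Q.S × List Bool}
    (hX : WellFormed (Q.raw s) X) (h : Q.δ s X.head?.join = some r) :
    WellFormed (Q.raw r.1) X.tail := by
  cases hraw : Q.raw s with
  | false =>
    rw [hraw] at hX
    have hr : Q.raw r.1 = false := by
      cases hx : X.head?.join with
      | none => rw [hx] at h; exact Q.raw_none _ _ h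
      | some b => rw [hx] at h; rw [Q.raw_some _ _ _ h, hraw]
    rw [hr]
    exact fun hm => hX (List.mem_of_mem_tail hm)
  | true =>
    rw [hraw] at hX
    obtain ⟨t, q, ht, hq, rfl⟩ := hX
    rcases t with _ | ⟨_ | b, t⟩
    · rw [Q.raw_none _ _ h]
      exact hq
    · simp at ht
    · rw [Q.raw_some _ _ _ h, hraw]
      exact ⟨t, q, fun h => ht (List.mem_cons_of_mem _ h), hq, rfl⟩

theorem WellFormed.append {f : Bool} {X : List (Option Bool)} (hX : WellFormed f X)
    (l : List Bool) : WellFormed f (X ++ l.map some) := by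
  cases f with
  | false =>
    have hX' : none ∉ X := hX
    simp [WellFormed, hX']
  | true =>
    obtain ⟨r, q, hr, hq, rfl⟩ := hX
    exact ⟨r, q ++ l.map some, hr, by simp [hq], by simp⟩

/-- One step marks the front pair, appends the new bits, and walks left to the nearest fully marked
pair. No queue entry is encoded as `(true, true)`, so that pair is the one just removed, and the new
front is to its right. -/
theorem step_simulation (a : ℕ) {c d : Q.S × List (Option Bool)}
    (hc : WellFormed (Q.raw c.1) c.2) (h : Q.step c = some d) :
    WellFormed (Q.raw d.1) d.2 ∧ d.2.length ≤ c.2.length + Q.bound ∧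
      Within Q.toTM.step ((Q.bound + 3) * (c.2.length + Q.bound + 2)) (toCfg a c)
        (toCfg (a + 1) d) := by
  obtain ⟨s, X⟩ := c
  simp only [step, Option.map_eq_some_iff] at h
  obtain ⟨⟨s', l⟩, hδ, rfl⟩ := h
  have hl : l.length ≤ Q.bound := Q.length_le _ _ _ hδ
  have hw := wellFormed_tail hc hδ
  have htail : X.tail.length ≤ X.length := by simp
  refine ⟨hw.append l, by simp; omega, ?_⟩
  obtain ⟨h', f', h₁, h₂, ha⟩ := within_append_of_wellFormed s' l hl a X.tail (Q.raw s') hw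
  obtain ⟨k, rfl⟩ := Nat.exists_eq_add_of_le h₁
  have htake : l.take Q.bound = l := List.take_of_length_le hl
  have h0 : Q.toTM.step (toCfg a (s, X)) =
      some ⟨.inr (s', ⟨l, hl⟩, Q.raw s'), a, tape (a + 1) X.tail⟩ := by
    refine step_eq_of_δ (b := (true, true)) (m := .stay) ?_ rfl (update_tape_front _ _).symm
    simp only [toTM, toCfg, unpair_tape, hδ, Option.map_some, htake]
  have hb : Within Q.toTM.step k
      ⟨.inr (s', ⟨[], Nat.zero_le _⟩, f'), a + k, tape (a + 1) (X.tail ++ l.map some)⟩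
      ⟨.inr (s', ⟨[], Nat.zero_le _⟩, f'), a, tape (a + 1) (X.tail ++ l.map some)⟩ :=
    within_left fun i hi => tape_ne_marked _ (by omega)
  have hz : Q.toTM.step
      ⟨.inr (s', ⟨[], Nat.zero_le _⟩, f'), a, tape (a + 1) (X.tail ++ l.map some)⟩ =
      some (toCfg (a + 1) (s', X.tail ++ l.map some)) := by
    refine step_eq_of_δ (b := tape (a + 1) (X.tail ++ l.map some) a) (m := .right) ?_ rfl
      (Function.update_eq_self _ _).symm
    exact if_pos (tape_of_lt _ (Nat.lt_succ_self a))
  refine ((((Within.single h0).trans ha).trans hb).trans (.single hz)).mono ?_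
  have e1 : (l.length + 1) * (X.tail.length + l.length + 2) ≤
      (Q.bound + 1) * (X.length + Q.bound + 2) := Nat.mul_le_mul (by omega) (by omega)
  -- The first summand pays for appending; the second for the walk back and the two single steps.
  have e2 : (Q.bound + 3) * (X.length + Q.bound + 2) =
    (Q.bound + 1) * (X.length + Q.bound + 2) + 2 * (X.length + Q.bound + 2) := by ring
  rw [e2]
  omega

/-- `B` bounds the length of the queue during the whole run, so each step has the same cost bound.
-/
theorem simulation {m : ℕ} {c d : Q.S × List (Option Bool)} (h : Within Q.step m c d)
    (hc : WellFormed (Q.raw c.1) c.2) (a B : ℕ) (hB : c.2.length + Q.bound * m ≤ B) :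
    ∃ a', Within Q.toTM.step (m * ((Q.bound + 3) * (B + Q.bound + 2))) (toCfg a c)
      (toCfg a' d) := by
  induction h generalizing a with
  | refl => exact ⟨a, .refl _ _⟩
  | @step n c c' d hs _ ih =>
    obtain ⟨hw, hlen, h1⟩ := step_simulation a hc hs
    rw [Nat.mul_succ] at hB
    obtain ⟨a', h2⟩ := ih hw (a + 1) (by omega)
    refine ⟨a', (h1.trans h2).mono ?_⟩
    rw [Nat.succ_mul n, Nat.add_comm]
    have : (Q.bound + 3) * (c.2.length + Q.bound + 2) ≤ (Q.bound + 3) * (B + Q.bound + 2) :=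
      Nat.mul_le_mul le_rfl (by omega)
    omega

/-- The separator comes for free: it is the blank pair after the encoded input. -/
theorem unpacked_toCfg_start (Q : QueueMachine) (w : List Bool) :
    (toCfg 0 (Q.start, w.map some ++ [none])).unpacked =
      Q.toTM.unpacked.init false (encode w) := by
  refine Cfg.eq_of_fields rfl rfl ?_
  have key : ∀ i, tape 0 (w.map some ++ [none]) i =
      (w.map fun b => (b, !b)).getD i (false, false) := by
    intro i
    rw [tape, if_neg (by omega), List.getD_eq_getElem?_getD, List.getD_eq_getElem?_getD,
      Nat.sub_zero, List.getElem?_map]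
    rcases lt_trichotomy i w.length with h | rfl | h
    · rw [List.getElem?_append_left (by simpa using h)]
      simp [h, pair]
    · simp [pair]
    · rw [List.getElem?_eq_none (by simp; omega), List.getElem?_eq_none (by omega)]
      rfl
  funext i
  obtain ⟨k, rfl | rfl⟩ : ∃ k, i = 2 * k ∨ i = 2 * k + 1 := ⟨i / 2, by omega⟩
  · exact (unpackTape_even _ _).trans ((congrArg _ (key k)).trans (getD_encode w k).1.symm)
  · exact (unpackTape_odd _ _).trans ((congrArg _ (key k)).trans (getD_encode w k).2.symm)

/-- What a queue machine answers, a write-once machine answers in polynomially related time. -/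
theorem answersWithin (Q : QueueMachine) (w : List Bool) {m : ℕ} {d : Q.S × List (Option Bool)}
    {p : Prop} (h : Within Q.step m (Q.start, w.map some ++ [none]) d) (hd : Q.step d = none)
    (hp : Q.accept d.1 = true ↔ p) :
    Q.toTM.unpacked.AnswersWithin (Q.toTM.unpacked.init false (encode w))
      (m * ((Q.bound + 3) * (w.length + 1 + Q.bound * m + Q.bound + 2)) * 4 + 1) p := by
  obtain ⟨a, ha⟩ := simulation h
    (by rw [Q.raw_start]; exact ⟨w.map some, [], by simp, by simp, rfl⟩) 0
    (w.length + 1 + Q.bound * m) (by simp)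
  rw [← unpacked_toCfg_start]
  refine Q.isMonotone_toTM.answersWithin_unpacked ha (halted_of_δ ?_) hp
  have : Q.δ d.1 d.2.head?.join = none := by simpa [step] using hd
  simp [toTM, toCfg, unpair_tape, this]

end QueueMachine

/-! ### Configurations as rows of cells, and the local rule. -/

section Rows

open TM

variable {Γ : Type} (M : TM Γ)

/-- The contents of a cell, with the state of the machine if the head is on it. -/
abbrev TM.Cell : Type := Γ × Option M.Q

variable {M}

/-- The cell `i` of a configuration. -/
def Cfg.cell (c : Cfg M) (i : ℕ) : M.Cell := (c.tape i, if i = c.head then some c.state else none)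

/-- The left neighbour of cell `i` of a configuration, if there is one. -/
def Cfg.leftCell (c : Cfg M) (i : ℕ) : Option M.Cell := if i = 0 then none else some (c.cell (i - 1))

/-- The cells `i`, …, `i + m - 1` of a configuration. -/
def Cfg.segment (c : Cfg M) (i m : ℕ) : List (Option M.Cell) :=
  (List.range' i m).map fun j => some (c.cell j)

theorem Cfg.segment_succ (c : Cfg M) (i m : ℕ) :
    c.segment i (m + 1) = some (c.cell i) :: c.segment (i + 1) m := by
  simp [Cfg.segment, List.range'_succ]

theorem Cfg.segment_succ' (c : Cfg M) (i m : ℕ) :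
    c.segment i (m + 1) = c.segment i m ++ [some (c.cell (i + m))] := by
  simp [Cfg.segment, List.range'_1_concat]

namespace TM.Cell

/-- The transition that is made from a cell with a state. -/
def transition (x : M.Cell) : Option (M.Q × Γ × Move) := x.2.bind fun q => M.δ q x.1

/-- The answer of the machine if it halts on the cell. -/
def answer (x : M.Cell) : Option Bool :=
  x.2.bind fun q => if (M.δ q x.1).isNone then some (M.accept q) else none

/-- The next contents of a cell, from those of the cell and its two neighbours. -/
def next (a : Option M.Cell) (b c : M.Cell) : M.Cell :=
  ((transition b).elim b.1 fun r => r.2.1,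
    match a.bind transition, transition b, transition c with
    | some (q, _, .right), _, _ => some q
    | _, some (q, _, .stay), _ => some q
    | _, some (q, _, .left), _ => if a.isNone then some q else none
    | _, _, some (q, _, .left) => some q
    | _, _, _ => none)

theorem transition_cell (c : Cfg M) (i : ℕ) :
    transition (c.cell i) = if i = c.head then M.δ c.state (c.tape c.head) else none := by
  unfold transition Cfg.cell
  split
  · next h => subst h; rfl
  · rfl

theorem answer_cell_of_step {c d : Cfg M} (h : M.step c = some d) (i : ℕ) :
    answer (c.cell i) = none := by
  obtain ⟨r, hr, -⟩ := step_eq_some h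
  unfold answer Cfg.cell
  split
  · next h => subst h; simp [hr]
  · rfl

theorem answer_cell_of_ne {c : Cfg M} {i : ℕ} (h : i ≠ c.head) : answer (c.cell i) = none := by
  simp [answer, Cfg.cell, h]

theorem answer_cell_of_halted {c : Cfg M} (h : M.Halted c) :
    answer (c.cell c.head) = some (M.accept c.state) := by
  have : M.δ c.state (c.tape c.head) = none := by simpa [Halted, step] using h
  simp [answer, Cfg.cell, this]

/-- The head moves by at most one cell, so only a head on cell `i` or next to it can affect cell
`i`. -/
theorem next_cell {c d : Cfg M} (h : M.step c = some d) (i : ℕ) :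
    next (c.leftCell i) (c.cell i) (c.cell (i + 1)) = d.cell i := by
  obtain ⟨⟨q, b, m⟩, hr, rfl⟩ := step_eq_some h
  have hl : (c.leftCell i).bind transition =
      if i = c.head + 1 then some (q, b, m) else none := by
    unfold Cfg.leftCell
    split
    · next h0 => rw [if_neg (by omega)]; rfl
    · next h0 =>
      rw [Option.bind_some, transition_cell, hr]
      congr 1
      exact propext (by omega)
  have hn : (c.leftCell i).isNone = decide (i = 0) := by
    unfold Cfg.leftCell
    split <;> simp [*]
  simp only [next, hl, hn, transition_cell, hr]
  rcases Nat.lt_trichotomy i c.head with hi | hi | hi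
  · rcases Nat.eq_or_lt_of_le (Nat.succ_le_of_lt hi) with hj | hj
    · have e1 : i ≠ c.head + 1 := by omega
      have e2 : i ≠ c.head := by omega
      have e3 : i + 1 = c.head := hj
      have e4 : i = c.head - 1 := by omega
      cases m <;> simp [Cfg.cell, Move.apply, e1, e2, e3, ← e4]
    · have e1 : i ≠ c.head + 1 := by omega
      have e2 : i ≠ c.head := by omega
      have e3 : i + 1 ≠ c.head := by omega
      have e4 : i ≠ c.head - 1 := by omega
      cases m <;> simp [Cfg.cell, Move.apply, e1, e2, e3, e4]
  · subst hi
    -- A left move keeps the state in its cell only at the left end, which `next` detects by the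
    -- missing left neighbour.
    have e3 : (c.head = c.head - 1) ↔ c.head = 0 := by omega
    cases m <;> simp [Cfg.cell, Move.apply, e3]
  · have e2 : i ≠ c.head := by omega
    have e3 : i + 1 ≠ c.head := by omega
    have e4 : i ≠ c.head - 1 := by omega
    by_cases e1 : i = c.head + 1
    · have e6 : c.head + 1 + 1 ≠ c.head := by omega
      have e5 : c.head + 1 ≠ c.head - 1 := by omega
      cases m <;> simp [Cfg.cell, Move.apply, e1, e5, e6]
    · cases m <;> simp [Cfg.cell, Move.apply, e1, e2, e3, e4]

end TM.Cell

theorem Cfg.cell_eq_blank {c : Cfg M} {blank : Γ} {L i : ℕ} (hc : ∀ j, L ≤ j → c.tape j = blank)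
    (hh : c.head < L) (hi : L ≤ i) : c.cell i = (blank, none) := by
  rw [Cfg.cell, hc i hi, if_neg (by omega)]

/-! ### The queue machine that computes successive rows: `P ⊆ DWOPSpace`. -/

variable [Fintype Γ]

noncomputable instance : Fintype (Option M.Cell) :=
  letI := M.finQ
  inferInstance

/-- The number of symbols of the rows. -/
noncomputable def TM.symbolCount (M : TM Γ) : ℕ := Fintype.card (Option M.Cell)

/-- A numbering of the symbols of the rows. -/
noncomputable def symbolIndex : Option M.Cell ≃ Fin M.symbolCount := Fintype.equivFin _

/-- The unary code of a symbol. -/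
noncomputable def code (x : Option M.Cell) : List Bool :=
  List.replicate (symbolIndex x) true ++ [false]

theorem length_code_le (x : Option M.Cell) : (code x).length ≤ M.symbolCount := by
  simp only [code, List.length_append, List.length_replicate, List.length_singleton]
  exact (symbolIndex x).2

/-- The initial value of the counter of the symbol that is read. -/
noncomputable def counterZero : Fin M.symbolCount := ⟨0, Fintype.card_pos⟩

/-- The states of the queue machine that computes the successive rows: reading the input (before or
after its first bit), reading a row (with the last two symbols and the counter of the current one),
halting. -/
abbrev RowState (M : TM Γ) : Type :=
  Bool ⊕ (Option M.Cell × Option M.Cell × Fin M.symbolCount) ⊕ Bool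

/-- The state that follows a symbol `x` of a row, where `a` and `b` are the preceding symbols, and
the symbols of the next row that are appended. -/
noncomputable def readSymbol (blank : Γ) (a b : Option M.Cell) :
    Option M.Cell → RowState M × List (Option M.Cell)
  | some x => match Cell.answer x with
    | some r => (.inr (.inr r), [])
    | none => (.inr (.inl (b, some x, counterZero)), match b with
      | none => []
      | some y => [some (Cell.next a y x)])
  | none => (.inr (.inl (none, none, counterZero)), match b with
      | none => []
      | some y => [some (Cell.next a y (blank, none)),
          some (Cell.next (some y) (blank, none) (blank, none)), none])

theorem length_readSymbol_le (blank : Γ) (a b x : Option M.Cell) :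
    (readSymbol blank a b x).2.length ≤ 3 := by
  unfold readSymbol
  rcases x with _ | x
  · cases b <;> simp
  · dsimp only
    split
    · simp
    · cases b <;> simp

theorem length_flatMap_code_le (l : List (Option M.Cell)) :
    (l.flatMap code).length ≤ l.length * M.symbolCount := by
  induction l with
  | nil => simp
  | cons x l ih =>
    rw [List.flatMap_cons, List.length_append, List.length_cons, Nat.succ_mul]
    have := length_code_le x
    omega

/-- The queue machine that computes the successive rows of a Turing machine. -/
noncomputable def TM.rowMachine (M : TM Γ) (blank : Γ) (letter : Bool → Γ) : QueueMachine where
  S := RowState M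
  finS := letI := M.finQ; inferInstance
  start := .inl true
  accept s := match s with
    | .inr (.inr r) => r
    | _ => false
  raw s := s.isLeft
  δ s x := match s, x with
    | .inl f, some b => some (.inl false, code (some (letter b, if f then some M.start else none)))
    | .inl f, none => some (.inr (.inl (none, none, counterZero)),
        code (some (blank, if f then some M.start else none)) ++ code none)
    | .inr (.inl (a, b, j)), some true =>
        some (.inr (.inl (a, b, if h : j + 1 < M.symbolCount then ⟨j + 1, h⟩ else j)), [])
    | .inr (.inl (a, b, j)), some false =>
        some ((readSymbol blank a b (symbolIndex.symm j)).1,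
          (readSymbol blank a b (symbolIndex.symm j)).2.flatMap code)
    | _, _ => none
  bound := 3 * M.symbolCount
  raw_start := rfl
  length_le := by
    rintro (f | ⟨a, b, j⟩ | r) (_ | _ | _) ⟨s', l⟩ h <;>
      simp only [Option.some.injEq, Prod.mk.injEq, reduceCtorEq] at h
    · have h1 := length_code_le (some ((blank, if f then some M.start else none) : M.Cell))
      have h2 := length_code_le (none : Option M.Cell)
      rw [← h.2, List.length_append]
      omega
    · have h1 := length_code_le (some ((letter false, if f then some M.start else none) : M.Cell))
      have h3 : l.length ≤ M.symbolCount := h.2 ▸ h1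
      exact h3.trans (by omega)
    · have h1 := length_code_le (some ((letter true, if f then some M.start else none) : M.Cell))
      have h3 : l.length ≤ M.symbolCount := h.2 ▸ h1
      exact h3.trans (by omega)
    · rw [← h.2]
      exact (length_flatMap_code_le _).trans
        (Nat.mul_le_mul_right _ (length_readSymbol_le _ _ _ _))
    · simp [← h.2]
  raw_some := by
    rintro (f | ⟨a, b, j⟩ | r) (_ | _) ⟨s', l⟩ h <;>
      simp only [Option.some.injEq, Prod.mk.injEq, reduceCtorEq] at h
    · rw [← h.1]; rfl
    · rw [← h.1]; rfl
    · rw [← h.1]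
      unfold readSymbol
      split
      · split <;> rfl
      · rfl
    · rw [← h.1]; rfl
  raw_none := by
    rintro (f | ⟨a, b, j⟩ | r) ⟨s', l⟩ h <;>
      simp only [Option.some.injEq, Prod.mk.injEq, reduceCtorEq] at h
    rw [← h.1]; rfl

variable {blank : Γ} {letter : Bool → Γ}

/-- The configuration of the row machine that is about to read the symbols `Y`. -/
noncomputable def rowCfg (a b : Option M.Cell) (Y : List (Option M.Cell)) :
    RowState M × List (Option Bool) :=
  (.inr (.inl (a, b, counterZero)), (Y.flatMap code).map some)

/-- By `h` the counter stays in range, so its saturating default is never used. -/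
theorem within_count (a b : Option M.Cell) (i j : ℕ) (h : j + i < M.symbolCount)
    (Z : List (Option Bool)) :
    Within (M.rowMachine blank letter).step i
      (.inr (.inl (a, b, ⟨j, by omega⟩)), List.replicate i (some true) ++ Z)
      (.inr (.inl (a, b, ⟨j + i, h⟩)), Z) := by
  induction i generalizing j with
  | zero => exact .refl _ _
  | succ i ih =>
    refine .step (c' := (.inr (.inl (a, b, ⟨j + 1, by omega⟩)),
      List.replicate i (some true) ++ Z)) ?_ ?_
    · have : j + 1 < M.symbolCount := by omega
      simp [QueueMachine.step, rowMachine, List.replicate_succ, this]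
    · have e : j + (i + 1) = j + 1 + i := by omega
      simp only [e]
      exact ih (j + 1) (by omega)

theorem within_readSymbol (a b x : Option M.Cell) (Y : List (Option M.Cell)) :
    Within (M.rowMachine blank letter).step M.symbolCount (rowCfg a b (x :: Y))
      ((readSymbol blank a b x).1,
        ((Y ++ (readSymbol blank a b x).2).flatMap code).map some) := by
  have h1 := within_count (blank := blank) (letter := letter) a b (symbolIndex x) 0
    (by simp) (some false :: (Y.flatMap code).map some)
  have h2 : (M.rowMachine blank letter).step
      (.inr (.inl (a, b, ⟨0 + symbolIndex x, by simp⟩)),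
        some false :: (Y.flatMap code).map some) =
      some ((readSymbol blank a b x).1,
        ((Y ++ (readSymbol blank a b x).2).flatMap code).map some) := by
    simp [QueueMachine.step, rowMachine]
  have h3 := h1.trans (.single h2)
  have e : rowCfg a b (x :: Y) = (.inr (.inl (a, b, ⟨0, Fintype.card_pos⟩)),
      List.replicate (symbolIndex x) (some true) ++ some false :: (Y.flatMap code).map some) := by
    simp [rowCfg, code, counterZero]
  rw [e]
  exact h3.mono (symbolIndex x).2

theorem within_readSymbol_of_eq {a b x a' b' : Option M.Cell} {l : List (Option M.Cell)}
    (h : readSymbol blank a b x = (.inr (.inl (a', b', counterZero)), l))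
    (Y : List (Option M.Cell)) :
    Within (M.rowMachine blank letter).step M.symbolCount (rowCfg a b (x :: Y))
      (rowCfg a' b' (Y ++ l)) := by
  have := within_readSymbol (blank := blank) (letter := letter) a b x Y
  rw [h] at this
  exact this

/-- A new cell can be appended only when the right neighbour of the old one has been read, so output
lags one symbol behind input; `Z` collects the part of the new row already produced. The end of the
row releases the last cell and one additional blank position, which makes room for a head moving
right. -/
theorem within_rest_of_row {c d : Cfg M} (h : M.step c = some d) (i m : ℕ)
    (hc : ∀ j, i + 1 + m ≤ j → c.tape j = blank) (hh : c.head < i + 1 + m)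
    (Z : List (Option M.Cell)) :
    Within (M.rowMachine blank letter).step ((m + 1) * M.symbolCount)
      (rowCfg (c.leftCell i) (some (c.cell i)) (c.segment (i + 1) m ++ none :: Z))
      (rowCfg none none (Z ++ d.segment i (m + 2) ++ [none])) := by
  induction m generalizing i Z with
  | zero =>
    have e1 : c.cell (i + 1) = (blank, none) := Cfg.cell_eq_blank hc hh (by omega)
    have e2 : c.cell (i + 1 + 1) = (blank, none) := Cfg.cell_eq_blank hc hh (by omega)
    have n1 := Cell.next_cell h i
    have n2 := Cell.next_cell h (i + 1)
    rw [e1] at n1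
    rw [e1, e2, Cfg.leftCell, if_neg (by omega), Nat.add_sub_cancel] at n2
    have := within_readSymbol_of_eq (blank := blank) (letter := letter) (a := c.leftCell i)
      (b := some (c.cell i)) (x := none) rfl Z
    dsimp only at this
    rw [n1, n2] at this
    simpa [Cfg.segment, List.range'_succ] using this
  | succ m ih =>
    rw [c.segment_succ, d.segment_succ, Nat.succ_mul, Nat.add_comm]
    have h1 := within_readSymbol_of_eq (blank := blank) (letter := letter) (a := c.leftCell i)
      (b := some (c.cell i)) (x := some (c.cell (i + 1))) (a' := some (c.cell i))
      (b' := some (c.cell (i + 1))) (l := [some (d.cell i)])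
      (by simp only [readSymbol, Cell.answer_cell_of_step h, Cell.next_cell h])
      (c.segment (i + 1 + 1) m ++ none :: Z)
    have h2 := ih (i + 1) (fun j hj => hc j (by omega)) (by omega) (Z ++ [some (d.cell i)])
    rw [Cfg.leftCell, if_neg (by omega), Nat.add_sub_cancel] at h2
    simp only [List.append_assoc, List.cons_append, List.nil_append] at h1 h2 ⊢
    exact h1.trans h2

theorem within_row {c d : Cfg M} (h : M.step c = some d) (L : ℕ)
    (hc : ∀ j, L ≤ j → c.tape j = blank) (hh : c.head < L) :
    Within (M.rowMachine blank letter).step ((L + 1) * M.symbolCount)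
      (rowCfg none none (c.segment 0 L ++ [none]))
      (rowCfg none none (d.segment 0 (L + 1) ++ [none])) := by
  obtain ⟨m, rfl⟩ : ∃ m, L = m + 1 := ⟨L - 1, by omega⟩
  have h1 := within_readSymbol_of_eq (blank := blank) (letter := letter) (a := none)
    (b := none) (x := some (c.cell 0)) (a' := none)
    (b' := some (c.cell 0)) (l := [])
    (by simp only [readSymbol, Cell.answer_cell_of_step h])
    (c.segment 1 m ++ [none])
  have h2 := within_rest_of_row (blank := blank) (letter := letter) h 0 m
    (fun j hj => hc j (by omega)) (by omega) []
  rw [c.segment_succ, Nat.succ_mul, Nat.add_comm]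
  rw [List.append_nil] at h1
  exact h1.trans h2

/-- Symbols appended before the head is found are meaningless but harmless, since the machine stops
at the head; hence the unspecified final queue `X`. -/
theorem within_halted_row {c : Cfg M} (h : M.Halted c) (m i : ℕ) (hi : i ≤ c.head)
    (hm : c.head < i + m) (a b : Option M.Cell) (Z : List (Option M.Cell)) :
    ∃ X, Within (M.rowMachine blank letter).step (m * M.symbolCount)
      (rowCfg a b (c.segment i m ++ Z)) (.inr (.inr (M.accept c.state)), X) := by
  induction m generalizing i a b Z with
  | zero => omega
  | succ m ih =>
    rw [c.segment_succ, List.cons_append]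
    rcases Nat.eq_or_lt_of_le hi with rfl | hlt
    · have h1 := within_readSymbol (blank := blank) (letter := letter) a b
        (some (c.cell c.head)) (c.segment (c.head + 1) m ++ Z)
      simp only [readSymbol, Cell.answer_cell_of_halted h] at h1
      exact ⟨_, h1.mono (Nat.le_mul_of_pos_left _ (by omega))⟩
    · have h1 := within_readSymbol_of_eq (blank := blank) (letter := letter) (a := a)
        (b := b) (x := some (c.cell i)) (a' := b) (b' := some (c.cell i))
        (by simp only [readSymbol, Cell.answer_cell_of_ne hlt.ne]; rfl)
        (c.segment (i + 1) m ++ Z)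
      rw [List.append_assoc] at h1
      obtain ⟨X, h2⟩ := ih (i + 1) (by omega) (by omega) b (some (c.cell i)) (Z ++ _)
      exact ⟨X, (h1.trans h2).mono (by rw [Nat.succ_mul]; omega)⟩

/-- At most `T + 1` rows are read. They grow by one cell per step, so with its end symbol each has
at most `L + T + 1` symbols, and a symbol costs at most `symbolCount` steps. -/
theorem within_rows (T : ℕ) (c : Cfg M) (L : ℕ) (hT : M.Halted (M.run c T))
    (hc : ∀ j, L ≤ j → c.tape j = blank) (hh : c.head < L) :
    ∃ X, Within (M.rowMachine blank letter).step ((T + 1) * ((L + T + 1) * M.symbolCount))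
      (rowCfg none none (c.segment 0 L ++ [none]))
      (.inr (.inr (M.accept (M.run c T).state)), X) := by
  have halting : ∀ {T c L}, M.Halted (M.run c T) → c.head < L → M.Halted c →
      ∃ X, Within (M.rowMachine blank letter).step ((T + 1) * ((L + T + 1) * M.symbolCount))
        (rowCfg none none (c.segment 0 L ++ [none]))
        (.inr (.inr (M.accept (M.run c T).state)), X) := by
    intro T c L hT hh hs
    rw [hs.run_eq]
    obtain ⟨X, hX⟩ := within_halted_row (blank := blank) (letter := letter) hs L 0
      (Nat.zero_le _) (by omega) none none [none]
    exact ⟨X, hX.mono ((Nat.mul_le_mul_right _ (by omega)).trans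
      (Nat.le_mul_of_pos_left _ (by omega)))⟩
  induction T generalizing c L with
  | zero => exact halting hT hh hT
  | succ T ih =>
    cases hs : M.step c with
    | none => exact halting hT hh hs
    | some d =>
      have hrun : M.run c (T + 1) = M.run d T := by rw [run_succ, hs]; rfl
      rw [hrun] at hT ⊢
      have hd : (∀ j, L + 1 ≤ j → d.tape j = blank) ∧ d.head < L + 1 := by
        obtain ⟨⟨q, b, m⟩, -, rfl⟩ := step_eq_some hs
        refine ⟨fun j hj => ?_, by cases m <;> simp [Move.apply] <;> omega⟩
        exact (Function.update_of_ne (by omega) _ _).trans (hc j (by omega))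
      obtain ⟨X, hX⟩ := ih d (L + 1) hT hd.1 hd.2
      refine ⟨X, ((within_row hs L hc hh).trans hX).mono ?_⟩
      rw [Nat.succ_mul (T + 1), Nat.add_comm, show L + (T + 1) + 1 = L + 1 + T + 1 by omega]
      exact Nat.add_le_add_left (Nat.mul_le_mul_right _ (by omega)) _

/-- Each input bit is replaced by the code of its cell, behind the separator. The first cell
appended carries the initial state; on empty input this is the blank cell appended at the separator,
so the row always contains the head. -/
theorem within_input (w : List Bool) (i m : ℕ) (h : i + m = w.length) :
    Within (M.rowMachine blank letter).step (m + 1)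
      (.inl (decide (i = 0)), (w.drop i).map some ++
        none :: (((M.init blank (w.map letter)).segment 0 i).flatMap code).map some)
      (rowCfg none none ((M.init blank (w.map letter)).segment 0 (w.length + 1) ++ [none])) := by
  have hcell : ∀ x i, (M.init blank (w.map letter)).tape i = x →
      (M.init blank (w.map letter)).cell i =
        (x, if decide (i = 0) = true then some M.start else none) := by
    intro x i hx
    rw [Cfg.cell, hx]
    simp [TM.init]
  induction m generalizing i with
  | zero =>
    obtain rfl : i = w.length := by omega
    refine .single ?_
    have ht := hcell blank w.length (by simp [TM.init])
    rw [Cfg.segment_succ', Nat.zero_add, ht]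
    simp [QueueMachine.step, rowMachine, rowCfg]
  | succ m ih =>
    have hi : i < w.length := by omega
    refine .step ?_ (ih (i + 1) (by omega))
    have ht := hcell (letter w[i]) i (by simp [TM.init, hi])
    rw [Cfg.segment_succ', Nat.zero_add, ht, List.drop_eq_getElem_cons hi]
    generalize w.drop (i + 1) = r
    simp [QueueMachine.step, rowMachine]

theorem P_subset_DWOPSpace : P ⊆ DWOPSpace := by
  rintro L ⟨Γ, _, blank, letter, M, p, -, -, h⟩
  let K := M.symbolCount
  -- `m` counts the queue steps: `n + 1` for the input of length `n`, then the cost of the rows with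
  -- `L = n + 1` and `T = p`. `t` is the resulting time on the write-once tape, with at most `3 * K`
  -- bits appended per queue step.
  let m : Polynomial ℕ := Polynomial.X + 1 +
    (p + 1) * ((Polynomial.X + 1 + p + 1) * Polynomial.C K)
  let t : Polynomial ℕ := m * ((Polynomial.C (3 * K) + 3) *
    (Polynomial.X + 1 + Polynomial.C (3 * K) * m + Polynomial.C (3 * K) + 2)) * 4 + 1
  refine ⟨(M.rowMachine blank letter).toTM.unpacked, t + 1, TM.isWriteOnce_unpacked _,
    fun w => ?_⟩
  obtain ⟨hT, hp⟩ := h w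
  obtain ⟨X, hX⟩ := within_rows (letter := letter) (blank := blank) (p.eval w.length)
    (M.init blank (w.map letter)) (w.length + 1) hT
    (fun j hj => by simp only [TM.init]; rw [List.getD_eq_default _ _ (by simp; omega)])
    (Nat.succ_pos _)
  have h0 := within_input (M := M) (blank := blank) (letter := letter) w 0 w.length (by omega)
  have hw := (M.rowMachine blank letter).answersWithin w (h0.trans hX) (by rfl) hp
  refine ⟨⟨_, hw⟩, ?_⟩
  have hs := hw.usesSpace rfl
  convert hs using 1
  simp only [t, m, Polynomial.eval_add, Polynomial.eval_mul, Polynomial.eval_C,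
    Polynomial.eval_X, Polynomial.eval_one, Polynomial.eval_ofNat]
  rfl

end Rows

end WriteOnce

theorem theorem1 : WriteOnce.DWOPSpace = WriteOnce.P :=
  Set.Subset.antisymm WriteOnce.DWOPSpace_subset_P WriteOnce.P_subset_DWOPSpace
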